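/- Let $d\ge 0$, let $\mathcal L_d$ be Lebesgue measure on $\mathbb R^d$, and let $M$ be the space of locally finite Borel measures on $\mathbb R^d$ with the $\sigma$-field generated by the maps $\varphi\mapsto\varphi(B)$, $B$ Borel. Let $(\Omega,\mathcal F)$ be a measurable space with a measurable flow $(\theta_s)_{s\in\mathbb R^d}$, i.e. $(\omega,s)\mapsto\theta_s\omega$ is measurable, $\theta_0=\mathrm{id}$ and $\theta_s\circ\theta_t=\theta_{s+t}$; for $\varphi\in M$ put $(\theta_s\varphi)(B)=\varphi(B+s)$. Let $\mathbb P$ be a probability measure on $\Omega$ that is invariant under every $\theta_s$ and ergodic (events invariant under all $\theta_s$ have probability $0$ or $1$), and let $\Psi:\Omega\to M$ be measurable and flow-adapted, i.e. $\Psi_{\theta_s\omega}=\theta_s\Psi_\omega$. Assume that $\Psi$ has intensity $\lambda\in(0,\infty)$, i.e. $\mathbb E[\Psi(B)]=\lambda\mathcal L_d(B)$ for all Borel $B$, and put $\Phi=\lambda\mathcal L_d$. Let $\mathbb P_\Psi$ be the Palm probability measure of $\Psi$, $$\mathbb P_\Psi(A)=\frac1{\lambda\mathcal L_d(B)}\,\mathbb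 E\Big[\int_B \mathbb 1_A(\theta_s)\,\Psi(ds)\Big],\qquad A\in\mathcal F,$$ where $B$ is any Borel set with $0<\mathcal L_d(B)<\infty$; the Palm version of $\Psi$ is $\Psi$ considered under $\mathbb P_\Psi$. Let $F=F_\omega(x,\xi)\in[0,\infty)$ be jointly measurable in $(\omega,x,\xi)\in\Omega\times\mathbb R^d\times\mathbb R^d$ and flow-adapted, i.e. $F_{\theta_s\omega}(x,\xi)=F_\omega(x+s,\xi+s)$, and suppose that for $\mathbb P$-almost every $\omega$ it is a balancing density for $\Phi$ and $\Psi_\omega$: $\int F_\omega(x,\xi)\,\Psi_\omega(d\xi)\le 1$ for every $x$, with equality for $\Phi$-a.e. $x$, and $\int F_\omega(x,\xi)\,\Phi(dx)\le 1$ for every $\xi$, with equality for $\Psi_\omega$-a.e. $\xi$. Then $\mathbb P_\Psi$ is a probability measure, and the following hold, for random vectors $Y$ in $\mathbb R^d$ that may be defined on an extension of the probability space in question. (i) If $Y$, on an extension of $(\Omega,\mathcal F,\mathbb P)$, has conditional distribution $F(0,\cdot)\Psi$ given $\Psi$, i.e. the measure $C\mapsto\int_C F(0,\xi)\,\Psi(d\xi)$,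 then $Y$ is a shift-coupling of $\Psi$ and its Palm version: $\theta_Y\Psi$ has the same distribution on $M$ as $\Psi$ under $\mathbb P_\Psi$. (ii) If $Y$, on an extension of $(\Omega,\mathcal F,\mathbb P_\Psi)$, has conditional distribution $F(\cdot,0)\Phi$ given $\Psi$, i.e. the measure $C\mapsto\int_C F(x,0)\,\Phi(dx)$, then $\theta_Y\Psi$ has the same distribution on $M$ as $\Psi$ under $\mathbb P$. Here "$Y$ has conditional distribution $\kappa$ given $\Psi$" means that the probability of $\{\Psi\in A,\,Y\in C\}$ is the expectation of $\mathbb 1_{\{\Psi\in A\}}\,\kappa(C)$, for all measurable $A\subseteq M$ and $C\subseteq\mathbb R^d$. -/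

import Mathlib

open MeasureTheory Set
open scoped ENNReal NNReal

noncomputable section

/-- `ℝ^d`, with its Borel `σ`-field and Lebesgue measure `volume`. -/
abbrev Rd (d : ℕ) : Type := EuclideanSpace ℝ (Fin d)

/-- The space `M` of locally finite Borel measures on `ℝ^d`. As a subtype of `Measure (Rd d)` it
carries the smallest `σ`-field that makes all evaluations `φ ↦ φ B`, `B` Borel, measurable. -/
abbrev LFMeasure (d : ℕ) : Type := {φ : Measure (Rd d) // IsLocallyFiniteMeasure φ}

/-- The translate `θ_s φ` of a locally finite measure: `(θ_s φ)(B) = φ (B + s)`. -/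
def LFMeasure.shift {d : ℕ} (s : Rd d) (φ : LFMeasure d) : LFMeasure d :=
  ⟨φ.1.map (fun x => x - s), by
    have : IsLocallyFiniteMeasure φ.1 := φ.2
    refine ⟨fun x => ?_⟩
    obtain ⟨U, hU, hfin⟩ := φ.1.finiteAt_nhds (x + s)
    refine ⟨(fun y => y + s) ⁻¹' U, (continuous_id.add continuous_const).continuousAt hU, ?_⟩
    change φ.1.map (Homeomorph.subRight s).toMeasurableEquiv _ < ∞
    rw [MeasurableEquiv.map_apply]
    convert hfin using 2
    ext y
    simp⟩

lemma LFMeasure.shift_apply {d : ℕ} (s : Rd d) (φ : LFMeasure d) (B : Set (Rd d)) :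
    (LFMeasure.shift s φ).1 B = φ.1 ((fun x => x + s) '' B) := by
  change (φ.1.map (Homeomorph.subRight s).toMeasurableEquiv) B = _
  rw [MeasurableEquiv.map_apply]
  congr 1
  ext x
  simp [sub_eq_add_neg]

/-- A measurable flow `(θ_s)`, `s ∈ ℝ^d`, on a measurable space `Ω`. -/
structure MeasurableFlow (d : ℕ) (Ω : Type*) [MeasurableSpace Ω] where
  toFun : Rd d → Ω → Ω
  measurable_uncurry : Measurable (fun p : Ω × Rd d => toFun p.2 p.1)
  map_zero : ∀ ω, toFun 0 ω = ω
  map_add : ∀ s t ω, toFun s (toFun t ω) = toFun (s + t) ω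

section Random

variable {d : ℕ} {Ω : Type*} [MeasurableSpace Ω]

/-- `P` is invariant under every `θ_s`. -/
def IsFlowStationary (θ : MeasurableFlow d Ω) (P : Measure Ω) : Prop :=
  ∀ s, MeasurePreserving (θ.toFun s) P P

/-- `P` is stationary and every event that is invariant under all `θ_s` has probability `0` or
`1`. -/
def IsFlowErgodic (θ : MeasurableFlow d Ω) (P : Measure Ω) : Prop :=
  IsFlowStationary θ P ∧
    ∀ A : Set Ω, MeasurableSet A → (∀ s, θ.toFun s ⁻¹' A = A) → P A = 0 ∨ P A = 1

/-- `(P, Ψ)` is an ergodic (stationary) random measure: `P` is an ergodic probability measure, and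
`Ψ : Ω → M` is measurable and flow-adapted. -/
structure IsErgodicRandomMeasure (θ : MeasurableFlow d Ω) (P : Measure Ω) (Ψ : Ω → LFMeasure d) :
    Prop where
  prob : IsProbabilityMeasure P
  ergodic : IsFlowErgodic θ P
  measurable : Measurable Ψ
  adapted : ∀ s ω, Ψ (θ.toFun s ω) = (Ψ ω).shift s

/-- `lam` is the intensity of the random measure `(P, Ψ)`: `E[Ψ(B)] = lam * vol(B)` for every
Borel set `B`. -/
def IsIntensity (P : Measure Ω) (Ψ : Ω → LFMeasure d) (lam : ℝ≥0∞) : Prop :=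
  ∀ B : Set (Rd d), MeasurableSet B → ∫⁻ ω, (Ψ ω).1 B ∂P = lam * volume B

/-- The Palm probability measure `P_Ψ` on `Ω`, computed with the window `B`:
`P_Ψ(A) = (lam * vol(B))⁻¹ * E[∫_B 1_A(θ_s) Ψ(ds)]`, see `palmMeasure_apply`. -/
def palmMeasure (θ : MeasurableFlow d Ω) (P : Measure Ω) (Ψ : Ω → LFMeasure d) (lam : ℝ≥0∞)
    (B : Set (Rd d)) : Measure Ω :=
  (lam * volume B)⁻¹ •
    P.bind (fun ω => ((Ψ ω).1.restrict B).map (fun s => θ.toFun s ω))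

lemma measurable_palm_integrand (θ : MeasurableFlow d Ω) {Ψ : Ω → LFMeasure d}
    (hΨ : Measurable Ψ) {B : Set (Rd d)} (hB : MeasurableSet B) :
    Measurable (fun ω => ((Ψ ω).1.restrict B).map (fun s => θ.toFun s ω)) := by
  refine Measure.measurable_of_measurable_coe _ fun A hA => ?_
  have hsec : ∀ ω, Measurable (fun s => θ.toFun s ω) := fun ω =>
    θ.measurable_uncurry.comp measurable_prodMk_left
  let T : Set (Ω × Rd d) := (fun p => θ.toFun p.2 p.1) ⁻¹' A
  have hT : MeasurableSet T := θ.measurable_uncurry hA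
  let κ : ℕ → ProbabilityTheory.Kernel Ω (Rd d) := fun n =>
    ⟨fun ω => ((Ψ ω).1.restrict B).restrict (Metric.closedBall 0 n), by
      refine Measure.measurable_of_measurable_coe _ fun C hC => ?_
      simp only [Measure.restrict_apply hC,
        Measure.restrict_apply (hC.inter Metric.isClosed_closedBall.measurableSet)]
      exact (Measure.measurable_coe
        ((hC.inter Metric.isClosed_closedBall.measurableSet).inter hB)).comp
          (measurable_subtype_coe.comp hΨ)⟩
  have hfin : ∀ n ω, IsFiniteMeasure (κ n ω) := fun n ω => by
    have : IsLocallyFiniteMeasure (Ψ ω).1 := (Ψ ω).2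
    refine ⟨?_⟩
    change (((Ψ ω).1.restrict B).restrict (Metric.closedBall 0 (n : ℝ))) univ < ∞
    rw [Measure.restrict_apply_univ]
    exact (Measure.restrict_apply_le _ _).trans_lt
      (isCompact_closedBall (0 : Rd d) n).measure_lt_top
  have key : ∀ ω, (((Ψ ω).1.restrict B).map (fun s => θ.toFun s ω)) A
      = ⨆ n, κ n ω (Prod.mk ω ⁻¹' T) := fun ω => by
    rw [Measure.map_apply (hsec ω) hA]
    change ((Ψ ω).1.restrict B) (Prod.mk ω ⁻¹' T) = ⨆ n : ℕ,
      (((Ψ ω).1.restrict B).restrict (Metric.closedBall 0 (n : ℝ))) (Prod.mk ω ⁻¹' T)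
    have hS : MeasurableSet (Prod.mk ω ⁻¹' T) := measurable_prodMk_left hT
    simp only [Measure.restrict_apply hS (s := Metric.closedBall _ _)]
    rw [← Monotone.measure_iUnion]
    · rw [← inter_iUnion, Metric.iUnion_closedBall_nat, inter_univ]
    · intro m n hmn
      exact inter_subset_inter_right _ (Metric.closedBall_subset_closedBall (by exact_mod_cast hmn))
  simp only [key]
  exact Measurable.iSup fun n =>
    ProbabilityTheory.Kernel.measurable_kernel_prodMk_left_of_finite hT (hfin n)

lemma palmMeasure_apply (θ : MeasurableFlow d Ω) (P : Measure Ω) {Ψ : Ω → LFMeasure d}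
    (hΨ : Measurable Ψ) (lam : ℝ≥0∞) {B : Set (Rd d)} (hB : MeasurableSet B)
    {A : Set Ω} (hA : MeasurableSet A) :
    palmMeasure θ P Ψ lam B A =
      (lam * volume B)⁻¹ * ∫⁻ ω, ∫⁻ s in B, A.indicator 1 (θ.toFun s ω) ∂(Ψ ω).1 ∂P := by
  have hsec : ∀ ω, Measurable (fun s => θ.toFun s ω) := fun ω =>
    θ.measurable_uncurry.comp measurable_prodMk_left
  rw [palmMeasure, Measure.smul_apply, smul_eq_mul,
    Measure.bind_apply hA (measurable_palm_integrand θ hΨ hB).aemeasurable]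
  congr 1
  refine lintegral_congr fun ω => ?_
  rw [← lintegral_indicator_one hA,
    lintegral_map (measurable_one.indicator hA) (hsec ω)]

end Random

section Density

variable {d : ℕ}

/-- A non-negative measurable `f(x, ξ)` whose integrals in `ξ` against `ψ` and in `x` against `φ`
are at most `1`. -/
structure IsSubBalancingDensity (φ ψ : Measure (Rd d)) (f : Rd d → Rd d → ℝ≥0) : Prop where
  measurable : Measurable (fun p : Rd d × Rd d => f p.1 p.2)
  left_le : ∀ x, ∫⁻ ξ, (f x ξ : ℝ≥0∞) ∂ψ ≤ 1
  right_le : ∀ ξ, ∫⁻ x, (f x ξ : ℝ≥0∞) ∂φ ≤ 1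

/-- A sub-balancing density for which both integrals equal `1` almost everywhere. -/
structure IsBalancingDensity (φ ψ : Measure (Rd d)) (f : Rd d → Rd d → ℝ≥0) : Prop extends
    IsSubBalancingDensity φ ψ f where
  left_eq : ∀ᵐ x ∂φ, ∫⁻ ξ, (f x ξ : ℝ≥0∞) ∂ψ = 1
  right_eq : ∀ᵐ ξ ∂ψ, ∫⁻ x, (f x ξ : ℝ≥0∞) ∂φ = 1

/-- `F_ω(x, ξ)` is jointly measurable and flow-adapted: `F_{θ_s ω}(x, ξ) = F_ω(x + s, ξ + s)`. -/
structure IsFlowAdaptedFunction {Ω : Type*} [MeasurableSpace Ω] (θ : MeasurableFlow d Ω)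
    (F : Ω → Rd d → Rd d → ℝ≥0) : Prop where
  measurable : Measurable (fun p : Ω × Rd d × Rd d => F p.1 p.2.1 p.2.2)
  adapted : ∀ s ω x ξ, F (θ.toFun s ω) x ξ = F ω (x + s) (ξ + s)

end Density

/-- The conditional distribution of `Y` given `X` is the random measure `κ`:
`P(X ∈ A, Y ∈ B) = E[1_{X ∈ A} κ(B)]` for all measurable `A`, `B`.
For `κ` that is a function of `X` this is the defining property of the conditional distribution.
For general `κ` it is implied both by "the conditional distribution of `Y` given `σ(X)` is a.s. `κ`"
and, when `κ` and `X` are functions of some `Z`, by "the conditional distribution of `Y` given `Z`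
is a.s. `κ`". -/
def HasCondDistribGiven {Ω S E : Type*} [MeasurableSpace Ω] [MeasurableSpace S]
    [MeasurableSpace E] (P : Measure Ω) (Y : Ω → E) (X : Ω → S) (κ : Ω → Measure E) : Prop :=
  ∀ A : Set S, MeasurableSet A → ∀ B : Set E, MeasurableSet B →
    P (X ⁻¹' A ∩ Y ⁻¹' B) = ∫⁻ ω in X ⁻¹' A, κ ω B ∂P

/-- Let `π : Ω' → Ω₁` exhibit `(Ω', P')` as an extension of the probability space `(Ω₁, P₁)`. The
random vector `Y` on `Ω'` is a shift-coupling of `(P₁, Φ₁)` and `(P₂, Φ₂)`: `θ_Y Φ₁` has the same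
distribution on `M` as `Φ₂` under `P₂`. -/
structure IsShiftCoupling {d : ℕ} {Ω' Ω₁ Ω₂ : Type*} [MeasurableSpace Ω'] [MeasurableSpace Ω₁]
    [MeasurableSpace Ω₂] (P' : Measure Ω') (π : Ω' → Ω₁) (Y : Ω' → Rd d)
    (P₁ : Measure Ω₁) (Φ₁ : Ω₁ → LFMeasure d) (P₂ : Measure Ω₂) (Φ₂ : Ω₂ → LFMeasure d) :
    Prop where
  extension : MeasurePreserving π P' P₁
  measurable_vector : Measurable Y
  measurable_shift : Measurable (fun ω' => (Φ₁ (π ω')).shift (Y ω'))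
  map_eq : P'.map (fun ω' => (Φ₁ (π ω')).shift (Y ω')) = P₂.map Φ₂

end

/-! ### S-finiteness and measurability on the space of locally finite measures -/

open ProbabilityTheory

/-! The theorem is a mass-transport argument. The refined Campbell theorem
(`lintegral_palmMeasure_lintegral`) says that `E_Ψ ∫ h(ω, x) Φ(dx) = E ∫ h(θ_s ω, -s) Ψ(ds)`, where
`E_Ψ` is expectation under the Palm measure. Put `h(ω, x) = F_ω(x, 0) u(ω, θ_x ω)`. Adaptedness
gives `F_{θ_s ω}(-s, 0) = F_ω(0, s)`, so the right side becomes `E ∫ F_ω(0, s) u(θ_s ω, ω) Ψ(ds)`: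
moving from a stationary outcome by `F(0, ·)Ψ` is the time reversal of moving from a Palm outcome by
`F(·, 0)Φ`.

If `u` depends on its first argument only, the inner integral on the Palm side is the total mass of
`F(·, 0)Φ`, and (i) follows once this mass is 1 almost surely under the Palm measure. If `u` depends
on its second argument only, (ii) follows in the same way from the total mass of `F(0, ·)Ψ` under
`P`.

The balancing equalities hold only at almost every point and have to be moved to the origin. For `Φ`
this is Fubini and stationarity (`IsFlowStationary.ae_of_ae_ae`); for `Ψ` it is built into the Palm
measure (`ae_palmMeasure_of_ae`). -/

/-- A kernel all of whose values are finite measures is s-finite. -/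
theorem ProbabilityTheory.Kernel.isSFiniteKernel_of_isFiniteMeasure {α β : Type*}
    [MeasurableSpace α] [MeasurableSpace β] (κ : Kernel α β) (h : ∀ a, IsFiniteMeasure (κ a)) :
    IsSFiniteKernel κ := by
  -- The masses need not be uniformly bounded in `a`. Slicing the parameter space by the integer
  -- part of the mass leaves the bound `n + 1` on slice `n`.
  have hm : Measurable fun a => ⌊(κ a univ).toReal⌋₊ :=
    Nat.measurable_floor.comp (κ.measurable_coe MeasurableSet.univ).ennreal_toReal
  have hs : ∀ n : ℕ, MeasurableSet {a | ⌊(κ a univ).toReal⌋₊ = n} := fun n =>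
    hm (measurableSet_singleton n)
  classical
  have hsum : κ = Kernel.sum fun n : ℕ => Kernel.piecewise (hs n) κ 0 := by
    ext a t ht
    rw [Kernel.sum_apply' _ _ ht, tsum_eq_single ⌊(κ a univ).toReal⌋₊]
    · simp [Kernel.piecewise_apply']
    · intro n hn
      simp [Kernel.piecewise_apply', hn.symm]
  rw [hsum]
  refine Kernel.isSFiniteKernel_sum (hκs := fun n => ?_)
  suffices IsFiniteKernel (Kernel.piecewise (hs n) κ 0) by infer_instance
  refine ⟨⟨(n + 1 : ℕ), ENNReal.natCast_lt_top _, fun a => ?_⟩⟩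
  rw [Kernel.piecewise_apply']
  split_ifs with ha
  · have hlt := (Nat.lt_floor_add_one (κ a univ).toReal).le
    rw [show ⌊(κ a univ).toReal⌋₊ = n from ha] at hlt
    rw [← ENNReal.ofReal_toReal (measure_ne_top (κ a) univ), ← ENNReal.ofReal_natCast]
    exact ENNReal.ofReal_le_ofReal (by exact_mod_cast hlt)
  · simp

/-- The tautological kernel from locally finite measures on `ℝ^d` to `ℝ^d`. -/
noncomputable def LFMeasure.kernel (d : ℕ) : Kernel (LFMeasure d) (Rd d) :=
  ⟨Subtype.val, measurable_subtype_coe⟩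

/-- Needed for Fubini. Cut space into bounded shells: local finiteness makes each shell's mass
finite for every `φ`, though not uniformly in `φ`. -/
instance LFMeasure.isSFiniteKernel_kernel (d : ℕ) : IsSFiniteKernel (LFMeasure.kernel d) := by
  let D : ℕ → Set (Rd d) := disjointed fun n : ℕ => Metric.closedBall (0 : Rd d) n
  have hD : ∀ n, MeasurableSet (D n) := fun n =>
    MeasurableSet.disjointed (fun n => Metric.isClosed_closedBall.measurableSet) n
  have hU : ⋃ n, D n = univ := by
    rw [iUnion_disjointed, Metric.iUnion_closedBall_nat]
  have hsum : LFMeasure.kernel d = Kernel.sum fun n => (LFMeasure.kernel d).restrict (hD n) := by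
    ext φ t ht
    rw [Kernel.sum_apply' _ _ ht]
    simp only [Kernel.restrict_apply' _ _ _ ht]
    rw [← measure_iUnion, ← inter_iUnion, hU, inter_univ]
    · intro i j hij
      exact (disjoint_disjointed _ hij).mono inter_subset_right inter_subset_right
    · exact fun n => ht.inter (hD n)
  rw [hsum]
  refine Kernel.isSFiniteKernel_sum (hκs := fun n => ?_)
  refine Kernel.isSFiniteKernel_of_isFiniteMeasure _ fun φ => ⟨?_⟩
  have : IsLocallyFiniteMeasure φ.1 := φ.2
  rw [Kernel.restrict_apply, Measure.restrict_apply_univ]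
  change φ.1 (D n) < ∞
  exact (measure_mono (disjointed_subset _ n)).trans_lt
    (isCompact_closedBall (0 : Rd d) n).measure_lt_top

/-- Translation of locally finite measures is jointly measurable. -/
theorem LFMeasure.measurable_shift (d : ℕ) :
    Measurable fun p : LFMeasure d × Rd d => LFMeasure.shift p.2 p.1 := by
  refine Measurable.subtype_mk (Measure.measurable_of_measurable_coe _ fun A hA => ?_)
  have hT : MeasurableSet {q : (LFMeasure d × Rd d) × Rd d | q.2 - q.1.2 ∈ A} :=
    (measurable_snd.sub measurable_fst.snd) hA
  let κ : Kernel (LFMeasure d × Rd d) (Rd d) := (LFMeasure.kernel d).comap Prod.fst measurable_fst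
  have heq : (fun p : LFMeasure d × Rd d => p.1.1.map (fun x => x - p.2) A) = fun p =>
      κ p (Prod.mk p ⁻¹' {q : (LFMeasure d × Rd d) × Rd d | q.2 - q.1.2 ∈ A}) := by
    funext p
    exact Measure.map_apply (measurable_id.sub_const p.2) hA
  exact heq ▸ Kernel.measurable_kernel_prodMk_left hT

/-! ### Campbell measures, Palm measures and the refined Campbell theorem -/

section Campbell

variable {d : ℕ} {Ω : Type*} [MeasurableSpace Ω]

/-- A random measure as a kernel. -/
noncomputable def randomMeasureKernel (Ψ : Ω → LFMeasure d) (hΨ : Measurable Ψ) :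
    Kernel Ω (Rd d) :=
  (LFMeasure.kernel d).comap Ψ hΨ

instance (Ψ : Ω → LFMeasure d) (hΨ : Measurable Ψ) :
    IsSFiniteKernel (randomMeasureKernel Ψ hΨ) := by
  unfold randomMeasureKernel
  infer_instance

/-- The Campbell measure `E ∫ 1{(ω, s) ∈ ·} Ψ(ds)` on `Ω × ℝ^d` of a random measure. -/
noncomputable def campbellMeasure (P : Measure Ω) (Ψ : Ω → LFMeasure d) (hΨ : Measurable Ψ) :
    Measure (Ω × Rd d) :=
  P.compProd (randomMeasureKernel Ψ hΨ)

instance (P : Measure Ω) (Ψ : Ω → LFMeasure d) (hΨ : Measurable Ψ) :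
    SFinite (campbellMeasure P Ψ hΨ) := by
  unfold campbellMeasure
  infer_instance

theorem lintegral_campbellMeasure (P : Measure Ω) [SFinite P] (Ψ : Ω → LFMeasure d)
    (hΨ : Measurable Ψ) {f : Ω × Rd d → ℝ≥0∞} (hf : Measurable f) :
    ∫⁻ p, f p ∂campbellMeasure P Ψ hΨ = ∫⁻ ω, ∫⁻ s, f (ω, s) ∂(Ψ ω).1 ∂P :=
  Measure.lintegral_compProd hf

theorem MeasurableFlow.measurable_toFun_comp (θ : MeasurableFlow d Ω) {α : Type*}
    [MeasurableSpace α] {f : α → Ω} {g : α → Rd d} (hf : Measurable f) (hg : Measurable g) :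
    Measurable fun a => θ.toFun (g a) (f a) :=
  θ.measurable_uncurry.comp (hf.prodMk hg)

/-- The Campbell measure of a stationary random measure is invariant under
`(ω, s) ↦ (θ_t ω, s - t)`. -/
theorem lintegral_campbellMeasure_shift (θ : MeasurableFlow d Ω) {P : Measure Ω} [SFinite P]
    (hP : IsFlowStationary θ P) {Ψ : Ω → LFMeasure d} (hΨ : Measurable Ψ)
    (hΨθ : ∀ s ω, Ψ (θ.toFun s ω) = (Ψ ω).shift s) {g : Ω × Rd d → ℝ≥0∞} (hg : Measurable g)
    (t : Rd d) :
    ∫⁻ p, g (θ.toFun t p.1, p.2 - t) ∂campbellMeasure P Ψ hΨ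
      = ∫⁻ p, g p ∂campbellMeasure P Ψ hΨ := by
  have hθ : Measurable (θ.toFun t) := (hP t).measurable
  have hinner : Measurable fun ω => ∫⁻ s, g (ω, s) ∂(Ψ ω).1 :=
    hg.lintegral_kernel_prod_right' (κ := randomMeasureKernel Ψ hΨ)
  rw [lintegral_campbellMeasure P Ψ hΨ hg, ← (hP t).lintegral_comp hinner,
    lintegral_campbellMeasure P Ψ hΨ (f := fun p => g (θ.toFun t p.1, p.2 - t))
      (hg.comp ((hθ.comp measurable_fst).prodMk (measurable_snd.sub_const t)))]
  refine lintegral_congr fun ω => ?_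
  -- By adaptedness, `Ψ` at `θ_t ω` is the image of `Ψ_ω` under `s ↦ s - t`.
  rw [hΨθ]
  exact (lintegral_map (f := fun s => g (θ.toFun t ω, s)) (hg.comp measurable_prodMk_left)
    (measurable_id.sub_const t)).symm

/-- Expresses Palm integrals through the Campbell measure, where shift invariance and Tonelli are
available. -/
theorem lintegral_palmMeasure (θ : MeasurableFlow d Ω) {P : Measure Ω} [SFinite P]
    {Ψ : Ω → LFMeasure d} (hΨ : Measurable Ψ) (lam : ℝ≥0∞) {B : Set (Rd d)}
    (hB : MeasurableSet B) {f : Ω → ℝ≥0∞} (hf : Measurable f) :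
    ∫⁻ ω, f ω ∂palmMeasure θ P Ψ lam B
      = (lam * volume B)⁻¹ *
        ∫⁻ p, B.indicator 1 p.2 * f (θ.toFun p.2 p.1) ∂campbellMeasure P Ψ hΨ := by
  have hsec : ∀ ω, Measurable (fun s => θ.toFun s ω) := fun ω =>
    θ.measurable_toFun_comp measurable_const measurable_id
  rw [palmMeasure, lintegral_smul_measure, smul_eq_mul,
    Measure.lintegral_bind (measurable_palm_integrand θ hΨ hB).aemeasurable hf.aemeasurable,
    lintegral_campbellMeasure P Ψ hΨ (f := fun p => B.indicator 1 p.2 * f (θ.toFun p.2 p.1))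
      (((measurable_one.indicator hB).comp measurable_snd).mul
        (hf.comp (θ.measurable_toFun_comp measurable_fst measurable_snd)))]
  congr 1
  refine lintegral_congr fun ω => ?_
  rw [lintegral_map hf (hsec ω), ← lintegral_indicator hB]
  refine lintegral_congr fun s => ?_
  by_cases hs : s ∈ B <;> simp [hs]

/-- The refined Campbell theorem. -/
theorem lintegral_palmMeasure_lintegral (θ : MeasurableFlow d Ω) {P : Measure Ω} [SFinite P]
    (hP : IsFlowStationary θ P) {Ψ : Ω → LFMeasure d} (hΨ : Measurable Ψ)
    (hΨθ : ∀ s ω, Ψ (θ.toFun s ω) = (Ψ ω).shift s) {lam : ℝ≥0} (hlam : 0 < lam)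
    {B : Set (Rd d)} (hB : MeasurableSet B) (hB_pos : 0 < volume B) (hB_fin : volume B < ∞)
    {h : Ω × Rd d → ℝ≥0∞} (hh : Measurable h) :
    ∫⁻ ω, ∫⁻ x, h (ω, x) ∂(lam • (volume : Measure (Rd d))) ∂palmMeasure θ P Ψ lam B
      = ∫⁻ p, h (θ.toFun p.2 p.1, -p.2) ∂campbellMeasure P Ψ hΨ := by
  set Q := campbellMeasure P Ψ hΨ
  have hone : Measurable (B.indicator (1 : Rd d → ℝ≥0∞)) := measurable_one.indicator hB
  have hint : Measurable fun ω => ∫⁻ x, h (ω, x) := hh.lintegral_prod_right'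
  have hθ : Measurable fun p : Ω × Rd d => θ.toFun p.2 p.1 := θ.measurable_uncurry
  -- Invariance is used twice. For fixed `x`, shifting by `-x` preserves `θ_s ω` and moves the
  -- window to `s + x`. After substituting `y = s + x`, shifting by `y` again preserves `θ_s ω` and
  -- turns `y - s` into `-s`, so only the window depends on `y` and it integrates to `volume B`.
  have key : ∫⁻ p, B.indicator 1 p.2 * ∫⁻ x, h (θ.toFun p.2 p.1, x) ∂volume ∂Q
      = volume B * ∫⁻ p, h (θ.toFun p.2 p.1, -p.2) ∂Q := by
    calc ∫⁻ p, B.indicator 1 p.2 * ∫⁻ x, h (θ.toFun p.2 p.1, x) ∂volume ∂Q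
        = ∫⁻ p, ∫⁻ x, B.indicator 1 p.2 * h (θ.toFun p.2 p.1, x) ∂volume ∂Q := by
          refine lintegral_congr fun p => ?_
          exact (lintegral_const_mul _ (hh.comp measurable_prodMk_left)).symm
      _ = ∫⁻ x, ∫⁻ p, B.indicator 1 p.2 * h (θ.toFun p.2 p.1, x) ∂Q := by
          refine lintegral_lintegral_swap (Measurable.aemeasurable ?_)
          exact (hone.comp measurable_fst.snd).mul
            (hh.comp ((hθ.comp measurable_fst).prodMk measurable_snd))
      _ = ∫⁻ x, ∫⁻ p, B.indicator 1 (p.2 + x) * h (θ.toFun p.2 p.1, x) ∂Q := by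
          refine lintegral_congr fun x => ?_
          rw [← lintegral_campbellMeasure_shift θ hP hΨ hΨθ
            (g := fun p => B.indicator 1 p.2 * h (θ.toFun p.2 p.1, x))
            ((hone.comp measurable_snd).mul (hh.comp (hθ.prodMk measurable_const))) (-x)]
          simp only [θ.map_add, sub_neg_eq_add, add_neg_cancel_right]
          rfl
      _ = ∫⁻ p, ∫⁻ x, B.indicator 1 (p.2 + x) * h (θ.toFun p.2 p.1, x) ∂volume ∂Q := by
          refine (lintegral_lintegral_swap (Measurable.aemeasurable ?_)).symm
          exact (hone.comp (measurable_fst.snd.add measurable_snd)).mul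
            (hh.comp ((hθ.comp measurable_fst).prodMk measurable_snd))
      _ = ∫⁻ p, ∫⁻ y, B.indicator 1 y * h (θ.toFun p.2 p.1, y - p.2) ∂volume ∂Q := by
          refine lintegral_congr fun p => ?_
          rw [← lintegral_add_left_eq_self
            (fun y => B.indicator 1 y * h (θ.toFun p.2 p.1, y - p.2)) p.2]
          simp only [add_sub_cancel_left]
      _ = ∫⁻ y, ∫⁻ p, B.indicator 1 y * h (θ.toFun p.2 p.1, y - p.2) ∂Q := by
          refine lintegral_lintegral_swap (Measurable.aemeasurable ?_)
          exact (hone.comp measurable_snd).mul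
            (hh.comp ((hθ.comp measurable_fst).prodMk (measurable_snd.sub measurable_fst.snd)))
      _ = ∫⁻ y, B.indicator 1 y * ∫⁻ p, h (θ.toFun p.2 p.1, -p.2) ∂Q := by
          refine lintegral_congr fun y => ?_
          rw [lintegral_const_mul (f := fun p : Ω × Rd d => h (θ.toFun p.2 p.1, y - p.2)) _
            (hh.comp (hθ.prodMk (measurable_const.sub measurable_snd))),
            ← lintegral_campbellMeasure_shift θ hP hΨ hΨθ
            (g := fun p => h (θ.toFun p.2 p.1, -p.2)) (hh.comp (hθ.prodMk measurable_snd.neg)) y]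
          simp only [θ.map_add, neg_sub, sub_add_cancel]
          rfl
      _ = volume B * ∫⁻ p, h (θ.toFun p.2 p.1, -p.2) ∂Q := by
          rw [lintegral_mul_const _ hone, lintegral_indicator_one hB]
  simp only [lintegral_smul_measure, ENNReal.smul_def, smul_eq_mul]
  rw [lintegral_const_mul _ hint, lintegral_palmMeasure θ hΨ lam hB hint, key]
  have hl : (lam : ℝ≥0∞) ≠ 0 := by exact_mod_cast hlam.ne'
  rw [ENNReal.mul_inv (Or.inl hl) (Or.inr hB_pos.ne'), ← mul_assoc, ← mul_assoc, ← mul_assoc,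
    ENNReal.mul_inv_cancel hl ENNReal.coe_ne_top, one_mul,
    ENNReal.inv_mul_cancel hB_pos.ne' hB_fin.ne, one_mul]

theorem isProbabilityMeasure_palmMeasure (θ : MeasurableFlow d Ω) {P : Measure Ω}
    {Ψ : Ω → LFMeasure d} (hΨ : Measurable Ψ) {lam : ℝ≥0} (hlam_pos : 0 < lam)
    (hlam : IsIntensity P Ψ lam)
    {B : Set (Rd d)} (hB : MeasurableSet B) (hB_pos : 0 < volume B) (hB_fin : volume B < ∞) :
    IsProbabilityMeasure (palmMeasure θ P Ψ lam B) := by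
  refine ⟨?_⟩
  rw [palmMeasure_apply θ P hΨ lam hB MeasurableSet.univ]
  simp only [indicator_univ, Pi.one_apply, lintegral_one, Measure.restrict_apply_univ]
  rw [hlam B hB]
  refine ENNReal.inv_mul_cancel (mul_ne_zero ?_ hB_pos.ne')
    (ENNReal.mul_ne_top ENNReal.coe_ne_top hB_fin.ne)
  exact_mod_cast hlam_pos.ne'

/-- If almost surely `θ_s ω` has a property for `Ψ`-almost every `s`, then the property holds
almost surely under the Palm measure. -/
theorem ae_palmMeasure_of_ae (θ : MeasurableFlow d Ω) {P : Measure Ω} [SFinite P]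
    {Ψ : Ω → LFMeasure d} (hΨ : Measurable Ψ) (lam : ℝ≥0∞)
    {B : Set (Rd d)} (hB : MeasurableSet B) {p : Ω → Prop} (hp : MeasurableSet {ω | p ω})
    (h : ∀ᵐ ω ∂P, ∀ᵐ s ∂(Ψ ω).1, p (θ.toFun s ω)) :
    ∀ᵐ ω ∂palmMeasure θ P Ψ lam B, p ω := by
  rw [ae_iff]
  change palmMeasure θ P Ψ lam B {ω | p ω}ᶜ = 0
  rw [palmMeasure_apply θ P hΨ lam hB hp.compl]
  refine mul_eq_zero_of_right _ ?_
  refine (lintegral_congr_ae ?_).trans lintegral_zero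
  filter_upwards [h] with ω hω
  refine (lintegral_congr_ae ?_).trans lintegral_zero
  filter_upwards [ae_restrict_of_ae hω] with s hs
  simp [hs]

end Campbell

/-! ### From conditional distributions to shift-couplings; transfer to the origin -/

section Coupling

variable {d : ℕ} {Ω : Type*} [MeasurableSpace Ω]

/-- If `Y` has conditional distribution `κ` given `X`, the law of `(X, Y)` is the mixture of `κ`. -/
theorem HasCondDistribGiven.map_prodMk {Ω' S E : Type*} [MeasurableSpace Ω'] [MeasurableSpace S]
    [MeasurableSpace E] {P' : Measure Ω'} {Q : Measure Ω} [IsFiniteMeasure Q] {π : Ω' → Ω}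
    (hπ : MeasurePreserving π P' Q) {Y : Ω' → E} (hY : Measurable Y) {X : Ω → S}
    (hX : Measurable X) (κ : Kernel Ω E) [IsSFiniteKernel κ]
    (h : HasCondDistribGiven P' Y (fun ω' => X (π ω')) fun ω' => κ (π ω')) :
    P'.map (fun ω' => (X (π ω'), Y ω')) = (Q.compProd κ).map fun p => (X p.1, p.2) := by
  have : IsFiniteMeasure P' := ⟨by
    rw [← preimage_univ (f := π), hπ.measure_preimage MeasurableSet.univ.nullMeasurableSet]
    exact measure_lt_top Q univ⟩
  have hXY : Measurable fun ω' => (X (π ω'), Y ω') := (hX.comp hπ.measurable).prodMk hY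
  have hXE : Measurable fun p : Ω × E => (X p.1, p.2) :=
    (hX.comp measurable_fst).prodMk measurable_snd
  -- Both laws are finite, so agreement on rectangles suffices, and there it is the hypothesis `h`.
  refine Measure.ext_prod fun {s t} hs ht => ?_
  rw [Measure.map_apply hXY (hs.prod ht),
    Measure.map_apply hXE (hs.prod ht)]
  change P' ((fun ω' => X (π ω')) ⁻¹' s ∩ Y ⁻¹' t) = (Q.compProd κ) ((X ⁻¹' s) ×ˢ t)
  rw [h s hs t ht, Measure.compProd_apply_prod (hX hs) ht]
  exact hπ.setLIntegral_comp_preimage (hX hs) (κ.measurable_coe ht)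

/-- A random vector whose conditional distribution is `κ` is a shift-coupling as soon as the
mixture of shifts by `κ` has the target law. -/
theorem HasCondDistribGiven.isShiftCoupling {Ω' Ω₂ : Type*} [MeasurableSpace Ω']
    [MeasurableSpace Ω₂] {P' : Measure Ω'} {P₁ : Measure Ω} [IsFiniteMeasure P₁] {π : Ω' → Ω}
    (hπ : MeasurePreserving π P' P₁) {Y : Ω' → Rd d} (hY : Measurable Y)
    {Φ₁ : Ω → LFMeasure d} (hΦ₁ : Measurable Φ₁) (κ : Kernel Ω (Rd d)) [IsSFiniteKernel κ]
    (h : HasCondDistribGiven P' Y (fun ω' => Φ₁ (π ω')) fun ω' => κ (π ω'))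
    {P₂ : Measure Ω₂} {Φ₂ : Ω₂ → LFMeasure d} (hΦ₂ : Measurable Φ₂)
    (heq : ∀ A : Set (LFMeasure d), MeasurableSet A →
      ∫⁻ ω, ∫⁻ y, A.indicator 1 ((Φ₁ ω).shift y) ∂κ ω ∂P₁ = P₂ (Φ₂ ⁻¹' A)) :
    IsShiftCoupling P' π Y P₁ Φ₁ P₂ Φ₂ := by
  have hsh := LFMeasure.measurable_shift d
  have hXY : Measurable fun ω' => (Φ₁ (π ω'), Y ω') := (hΦ₁.comp hπ.measurable).prodMk hY
  have hX1 : Measurable fun p : Ω × Rd d => (Φ₁ p.1, p.2) :=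
    (hΦ₁.comp measurable_fst).prodMk measurable_snd
  refine ⟨hπ, hY, hsh.comp hXY, ?_⟩
  ext A hA
  rw [Measure.map_apply hΦ₂ hA, ← heq A hA]
  have hmap : P'.map (fun ω' => (Φ₁ (π ω')).shift (Y ω'))
      = (P'.map fun ω' => (Φ₁ (π ω'), Y ω')).map fun p => LFMeasure.shift p.2 p.1 :=
    (Measure.map_map hsh hXY).symm
  have hind : Measurable (A.indicator (1 : LFMeasure d → ℝ≥0∞)) := measurable_one.indicator hA
  rw [hmap, h.map_prodMk hπ hY hΦ₁ κ, Measure.map_map hsh hX1, ← lintegral_indicator_one hA,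
    lintegral_map hind (hsh.comp hX1)]
  exact Measure.lintegral_compProd (hind.comp (hsh.comp hX1))

/-- If almost surely a property of the flow-shifted outcome holds at Lebesgue-almost every point,
then it holds almost surely at the origin. -/
theorem IsFlowStationary.ae_of_ae_ae {θ : MeasurableFlow d Ω} {P : Measure Ω} [SFinite P]
    (hP : IsFlowStationary θ P) {p : Ω → Prop} (hp : MeasurableSet {ω | p ω})
    (h : ∀ᵐ ω ∂P, ∀ᵐ x : Rd d, p (θ.toFun x ω)) : ∀ᵐ ω ∂P, p ω := by
  have hm : MeasurableSet {q : Ω × Rd d | p (θ.toFun q.2 q.1)} := θ.measurable_uncurry hp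
  have h' : ∀ᵐ x : Rd d, ∀ᵐ ω ∂P, p (θ.toFun x ω) :=
    (Measure.ae_ae_comm hm).1 h
  -- One good `x` is enough: `θ_x` preserves `P`.
  obtain ⟨x, hx⟩ := h'.exists
  rw [← (hP x).map_eq]
  exact (ae_map_iff (hP x).measurable.aemeasurable hp).2 hx

end Coupling

/-! ### The two shift-couplings -/

theorem theorem3p6 {d : ℕ} {Ω : Type*} [MeasurableSpace Ω] (θ : MeasurableFlow d Ω)
    (P : Measure Ω) (Ψ : Ω → LFMeasure d) (hΨ : IsErgodicRandomMeasure θ P Ψ)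
    (lam : ℝ≥0) (hlam_pos : 0 < lam) (hlam : IsIntensity P Ψ lam)
    (F : Ω → Rd d → Rd d → ℝ≥0) (hF : IsFlowAdaptedFunction θ F)
    (hFbal : ∀ᵐ ω ∂P, IsBalancingDensity (lam • (volume : Measure (Rd d))) (Ψ ω).1 (F ω))
    (B : Set (Rd d)) (hB : MeasurableSet B) (hB_pos : 0 < volume B) (hB_fin : volume B < ∞) :
    IsProbabilityMeasure (palmMeasure θ P Ψ lam B) ∧
    (∀ {Ω' : Type*} [MeasurableSpace Ω'] (P' : Measure Ω') (π : Ω' → Ω) (Y : Ω' → Rd d),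
      MeasurePreserving π P' P → Measurable Y →
      HasCondDistribGiven P' Y (fun ω' => Ψ (π ω'))
        (fun ω' => (Ψ (π ω')).1.withDensity (fun ξ => (F (π ω') 0 ξ : ℝ≥0∞))) →
      IsShiftCoupling P' π Y P Ψ (palmMeasure θ P Ψ lam B) Ψ) ∧
    (∀ {Ω' : Type*} [MeasurableSpace Ω'] (P' : Measure Ω') (π : Ω' → Ω) (Y : Ω' → Rd d),
      MeasurePreserving π P' (palmMeasure θ P Ψ lam B) → Measurable Y →
      HasCondDistribGiven P' Y (fun ω' => Ψ (π ω'))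
        (fun ω' => (lam • (volume : Measure (Rd d))).withDensity
          (fun x => (F (π ω') x 0 : ℝ≥0∞))) →
      IsShiftCoupling P' π Y (palmMeasure θ P Ψ lam B) Ψ P Ψ) := by
  have hPprob := hΨ.prob
  have hstat := hΨ.ergodic.1
  have hΨm := hΨ.measurable
  have hpalm : IsProbabilityMeasure (palmMeasure θ P Ψ lam B) :=
    isProbabilityMeasure_palmMeasure θ hΨm hlam_pos hlam hB hB_pos hB_fin
  have hθ : Measurable fun p : Ω × Rd d => θ.toFun p.2 p.1 := θ.measurable_uncurry
  have hF0 : Measurable fun p : Ω × Rd d => (F p.1 0 p.2 : ℝ≥0∞) :=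
    (hF.measurable.comp
      (measurable_fst.prodMk (measurable_const.prodMk measurable_snd))).coe_nnreal_ennreal
  have hF1 : Measurable fun p : Ω × Rd d => (F p.1 p.2 0 : ℝ≥0∞) :=
    (hF.measurable.comp
      (measurable_fst.prodMk (measurable_snd.prodMk measurable_const))).coe_nnreal_ennreal
  have hleft_meas : Measurable fun ω => ∫⁻ ξ, (F ω 0 ξ : ℝ≥0∞) ∂(Ψ ω).1 :=
    hF0.lintegral_kernel_prod_right' (κ := randomMeasureKernel Ψ hΨm)
  have hright_meas : Measurable fun ω =>
      ∫⁻ x, (F ω x 0 : ℝ≥0∞) ∂(lam • (volume : Measure (Rd d))) :=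
    hF1.lintegral_prod_right'
  have hleft : ∀ᵐ ω ∂P, ∫⁻ ξ, (F ω 0 ξ : ℝ≥0∞) ∂(Ψ ω).1 = 1 := by
    refine hstat.ae_of_ae_ae (hleft_meas (measurableSet_singleton 1)) ?_
    filter_upwards [hFbal] with ω hω
    have hae : ∀ᵐ x : Rd d, ∫⁻ ξ, (F ω x ξ : ℝ≥0∞) ∂(Ψ ω).1 = 1 :=
      (Measure.ae_smul_measure_iff hlam_pos.ne').1 hω.left_eq
    filter_upwards [hae] with x hx
    -- The mass sent out from the origin in `θ_x ω` is the mass sent out from `x` in `ω`.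
    rw [hΨ.adapted, ← hx]
    simp only [hF.adapted, zero_add]
    refine (lintegral_map (f := fun ξ => (F ω x (ξ + x) : ℝ≥0∞)) ?_
      (measurable_id.sub_const x)).trans (by simp)
    exact (hF.measurable.comp (measurable_const.prodMk
      (measurable_const.prodMk (measurable_id.add_const x)))).coe_nnreal_ennreal
  have hright : ∀ᵐ ω ∂palmMeasure θ P Ψ lam B,
      ∫⁻ x, (F ω x 0 : ℝ≥0∞) ∂(lam • (volume : Measure (Rd d))) = 1 := by
    refine ae_palmMeasure_of_ae θ hΨm lam hB (hright_meas (measurableSet_singleton 1)) ?_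
    filter_upwards [hFbal] with ω hω
    filter_upwards [hω.right_eq] with s hs
    rw [← hs]
    simp only [hF.adapted, zero_add]
    exact lintegral_add_right_eq_self (fun x => (F ω x s : ℝ≥0∞)) s
  -- Seen from `s`, transport from `0` to `s` is transport from `-s` to `0`.
  have hFs : ∀ (p : Ω × Rd d), F (θ.toFun p.2 p.1) (-p.2) 0 = F p.1 0 p.2 := fun p => by
    simp [hF.adapted]
  refine ⟨hpalm, ?_, ?_⟩
  · intro Ω' _ P' π Y hπ hY hcond
    let κ : Kernel Ω (Rd d) :=
      (randomMeasureKernel Ψ hΨm).withDensity fun ω ξ => (F ω 0 ξ : ℝ≥0∞)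
    refine HasCondDistribGiven.isShiftCoupling hπ hY hΨm κ ?_ hΨm fun A hA => ?_
    · have hκ : ∀ ω, κ ω = (Ψ ω).1.withDensity fun ξ => (F ω 0 ξ : ℝ≥0∞) := fun ω =>
        Kernel.withDensity_apply _ hF0 ω
      simpa only [hκ] using hcond
    have hind : Measurable (A.indicator (1 : LFMeasure d → ℝ≥0∞)) := measurable_one.indicator hA
    have hg : Measurable fun p : Ω × Rd d => (F p.1 p.2 0 : ℝ≥0∞) * A.indicator 1 (Ψ p.1) :=
      hF1.mul (hind.comp (hΨm.comp measurable_fst))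
    calc ∫⁻ ω, ∫⁻ y, A.indicator 1 ((Ψ ω).shift y) ∂κ ω ∂P
        = ∫⁻ ω, ∫⁻ y, (F ω 0 y : ℝ≥0∞) * A.indicator 1 (Ψ (θ.toFun y ω)) ∂(Ψ ω).1 ∂P := by
          refine lintegral_congr fun ω => ?_
          simp only [hΨ.adapted]
          exact Kernel.lintegral_withDensity _ hF0 ω
            (hind.comp ((LFMeasure.measurable_shift d).comp measurable_prodMk_left))
      _ = ∫⁻ p, (F p.1 0 p.2 : ℝ≥0∞) * A.indicator 1 (Ψ (θ.toFun p.2 p.1))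
            ∂campbellMeasure P Ψ hΨm :=
          (lintegral_campbellMeasure P Ψ hΨm (hF0.mul (hind.comp (hΨm.comp hθ)))).symm
      _ = ∫⁻ ω, ∫⁻ x, (F ω x 0 : ℝ≥0∞) * A.indicator 1 (Ψ ω)
            ∂(lam • (volume : Measure (Rd d))) ∂palmMeasure θ P Ψ lam B := by
          -- Time reversal: the target outcome `θ_s ω` becomes the Palm outcome, so the indicator no
          -- longer depends on `x`.
          rw [lintegral_palmMeasure_lintegral θ hstat hΨm hΨ.adapted hlam_pos hB hB_pos hB_fin hg]
          simp only [hFs]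
      _ = ∫⁻ ω, (Ψ ⁻¹' A).indicator 1 ω ∂palmMeasure θ P Ψ lam B := by
          refine lintegral_congr_ae ?_
          filter_upwards [hright] with ω hω
          rw [lintegral_mul_const (f := fun x => (F ω x 0 : ℝ≥0∞)) _ (hF1.comp
            measurable_prodMk_left), hω, one_mul]
          rfl
      _ = palmMeasure θ P Ψ lam B (Ψ ⁻¹' A) := lintegral_indicator_one (hΨm hA)
  · intro Ω' _ P' π Y hπ hY hcond
    let κ : Kernel Ω (Rd d) :=
      (Kernel.const Ω (lam • (volume : Measure (Rd d)))).withDensity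
        fun ω x => (F ω x 0 : ℝ≥0∞)
    refine HasCondDistribGiven.isShiftCoupling hπ hY hΨm κ ?_ hΨm fun A hA => ?_
    · have hκ : ∀ ω, κ ω = (lam • (volume : Measure (Rd d))).withDensity
          fun x => (F ω x 0 : ℝ≥0∞) := fun ω => Kernel.withDensity_apply _ hF1 ω
      simpa only [hκ] using hcond
    have hind : Measurable (A.indicator (1 : LFMeasure d → ℝ≥0∞)) := measurable_one.indicator hA
    have hg : Measurable fun p : Ω × Rd d =>
        (F p.1 p.2 0 : ℝ≥0∞) * A.indicator 1 (Ψ (θ.toFun p.2 p.1)) :=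
      hF1.mul (hind.comp (hΨm.comp hθ))
    calc ∫⁻ ω, ∫⁻ y, A.indicator 1 ((Ψ ω).shift y) ∂κ ω ∂palmMeasure θ P Ψ lam B
        = ∫⁻ ω, ∫⁻ x, (F ω x 0 : ℝ≥0∞) * A.indicator 1 (Ψ (θ.toFun x ω))
            ∂(lam • (volume : Measure (Rd d))) ∂palmMeasure θ P Ψ lam B := by
          refine lintegral_congr fun ω => ?_
          simp only [hΨ.adapted]
          exact Kernel.lintegral_withDensity _ hF1 ω
            (hind.comp ((LFMeasure.measurable_shift d).comp measurable_prodMk_left))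
      _ = ∫⁻ p, (F p.1 0 p.2 : ℝ≥0∞) * A.indicator 1 (Ψ p.1) ∂campbellMeasure P Ψ hΨm := by
          rw [lintegral_palmMeasure_lintegral θ hstat hΨm hΨ.adapted hlam_pos hB hB_pos hB_fin hg]
          -- The shift by `-s` returns `θ_s ω` to `ω`, so the indicator leaves the integral over
          -- `Ψ`.
          simp only [hFs, θ.map_add, neg_add_cancel, θ.map_zero]
      _ = ∫⁻ ω, ∫⁻ y, (F ω 0 y : ℝ≥0∞) * A.indicator 1 (Ψ ω) ∂(Ψ ω).1 ∂P :=
          lintegral_campbellMeasure P Ψ hΨm (hF0.mul (hind.comp (hΨm.comp measurable_fst)))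
      _ = ∫⁻ ω, (Ψ ⁻¹' A).indicator 1 ω ∂P := by
          refine lintegral_congr_ae ?_
          filter_upwards [hleft] with ω hω
          rw [lintegral_mul_const (f := fun y => (F ω 0 y : ℝ≥0∞)) _ (hF0.comp
            measurable_prodMk_left), hω, one_mul]
          rfl
      _ = P (Ψ ⁻¹' A) := lintegral_indicator_one (hΨm hA)
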